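/- Let $n\in\mathbb N$ and write permutations of $[n]=\{1,\dots,n\}$ as $\sigma=\sigma_1\dots\sigma_n\in\mathfrak S_n$. Order $\mathfrak S_n$ by the weak order: $\sigma\le\tau$ iff $\mathrm{inv}(\sigma)\subseteq\mathrm{inv}(\tau)$, where $\mathrm{inv}(\sigma)=\{(\sigma_i,\sigma_j): i<j,\ \sigma_i>\sigma_j\}$; this is a lattice. Write $]a,b[\,=\{a+1,\dots,b-1\}$. An arc is a quadruple $(a,b,n,S)$ with $1\le a<b\le n$ and $S\subseteq\,]a,b[$. A set $I$ of arcs is an arc ideal if $(a,d,n,S)\in I$ implies $(b,c,n,S\cap\,]b,c[)\in I$ for all $a\le b<c\le d$. Two arcs $(a,b,n,R)$ and $(c,d,n,S)$ cross if there are $r,s\in([a,b]\cap[c,d])\smallsetminus(\{a,b\}\cap\{c,d\})$ with $r\in(R\cup\{a,b\})\smallsetminus S$ and $s\in(S\cup\{c,d\})\smallsetminus R$. A noncrossing arc diagram is a set of arcs such that any two distinct arcs of it do not cross, have distinct left endpoints and have distinct right endpoints. For positions $i<j$ with $\sigma_i>\sigma_j$ put $$\alpha(i,j,\sigma)=\bigl(\sigma_j,\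 \sigma_i,\ n,\ \{\sigma_k : k<i,\ \sigma_k\in\,]\sigma_j,\sigma_i[\,\}\bigr),\qquad \delta(\sigma)=\{\alpha(i,i+1,\sigma) : \sigma_i>\sigma_{i+1}\}.$$ Let $\equiv$ be a lattice congruence of the weak order on $\mathfrak S_n$. Let $\pi_\downarrow(\sigma)$ be the minimum of the $\equiv$-class of $\sigma$, and let $I=I_\equiv$ be the set of arcs corresponding to the join-irreducible permutations $\sigma$ with $\pi_\downarrow(\sigma)=\sigma$, where a join-irreducible permutation corresponds to the arc of its unique descent. The noncrossing arc diagram of $I$ corresponding to the class of $\sigma$ is $\eta_I(\sigma)=\delta(\pi_\downarrow(\sigma))$. Let $B(\sigma)$ be the set of pairs $(i,j)$ with $1\le i<j\le n$, $\sigma_i>\sigma_j$ and $\sigma(]i,j[)\cap\,]\sigma_j,\sigma_i[\,=\varnothing$, ordered by $(i,j)\prec(k,\ell)$ iff $i\le k<\ell\le j$ and $\sigma_k\ge\sigma_i>\sigma_j\ge\sigma_\ell$. Let $B_I(\sigma)$ be the set of $\prec$-maximal elements of $\{(i,j)\in B(\sigma) : \alpha(i,j,\sigma)\in I\}$. Then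 $I$ is an arc ideal, and for every $\sigma\in\mathfrak S_n$, $$\eta_I(\sigma)=\delta(\pi_\downarrow(\sigma))=\{\alpha(i,j,\sigma) : (i,j)\in B_I(\sigma)\},$$ and this set is a noncrossing arc diagram all of whose arcs lie in $I$. -/

import Mathlib

/-! Permutations of `[n]` are elements `σ : Equiv.Perm (Fin n)` in one-line notation: `σ i` is the
value at position `i`. Positions and values are numbered from `0` to `n - 1`. -/

namespace ArcDiagram

variable {n : ℕ}

/-- The inversion set of `σ`: the pairs of values `(σ i, σ j)` with `i < j` and `σ i > σ j`. -/
def inv (σ : Equiv.Perm (Fin n)) : Set (Fin n × Fin n) :=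
  {p | ∃ i j : Fin n, i < j ∧ σ j < σ i ∧ p = (σ i, σ j)}

theorem mem_inv {σ : Equiv.Perm (Fin n)} {b a : Fin n} :
    (b, a) ∈ inv σ ↔ a < b ∧ σ.symm b < σ.symm a := by
  constructor
  · rintro ⟨i, j, hij, h, hp⟩
    obtain ⟨rfl, rfl⟩ := Prod.mk.inj hp
    simpa using ⟨h, hij⟩
  · rintro ⟨h, h'⟩
    exact ⟨σ.symm b, σ.symm a, h', by simpa using h, by simp⟩

theorem inv_injective : Function.Injective (inv (n := n)) := by
  intro σ τ h
  have key : ∀ x y : Fin n, σ.symm x < σ.symm y → τ.symm x < τ.symm y := by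
    intro x y hxy
    rcases lt_trichotomy x y with hlt | rfl | hgt
    · by_contra hcon
      have hne : τ.symm y ≠ τ.symm x := fun e => hlt.ne (τ.symm.injective e).symm
      have h1 : (y, x) ∈ inv τ := mem_inv.2 ⟨hlt, lt_of_le_of_ne (not_lt.1 hcon) hne⟩
      rw [← h] at h1
      exact lt_asymm hxy (mem_inv.1 h1).2
    · exact absurd hxy (lt_irrefl _)
    · have h1 : (x, y) ∈ inv σ := mem_inv.2 ⟨hgt, hxy⟩
      rw [h] at h1
      exact (mem_inv.1 h1).2
  have hm : StrictMono (fun i : Fin n => τ.symm (σ i)) := by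
    intro i j hij
    exact key _ _ (by simpa using hij)
  let e : Fin n ≃o Fin n := hm.orderIsoOfSurjective _ (by
    intro y
    exact ⟨σ.symm (τ y), by simp⟩)
  ext i
  have h1 : e i = i := by rw [Subsingleton.elim e (OrderIso.refl _)]; rfl
  have h2 : τ.symm (σ i) = i := h1
  rw [Equiv.symm_apply_eq] at h2
  rw [h2]

/-- The weak order: inclusion of inversion sets. -/
instance weakOrder : PartialOrder (Equiv.Perm (Fin n)) :=
  PartialOrder.lift inv inv_injective

theorem le_iff_inv {σ τ : Equiv.Perm (Fin n)} : σ ≤ τ ↔ inv σ ⊆ inv τ := Iff.rfl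

/-- A transitive and cotransitive set of decreasing pairs is an inversion set. -/
theorem exists_inv_eq (T : Set (Fin n × Fin n)) (hT : ∀ a b, (b, a) ∈ T → a < b)
    (htr : ∀ a b c, (c, b) ∈ T → (b, a) ∈ T → (c, a) ∈ T)
    (hco : ∀ a b c, a < b → b < c → (c, a) ∈ T → (c, b) ∈ T ∨ (b, a) ∈ T) :
    ∃ σ : Equiv.Perm (Fin n), inv σ = T := by
  classical
  -- `B x y`: the value `x` is to be placed before the value `y`
  let B : Fin n → Fin n → Prop := fun x y => (x < y ∧ (y, x) ∉ T) ∨ (x, y) ∈ T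
  have Birr : ∀ x, ¬ B x x := by
    rintro x (h | h)
    · exact lt_irrefl _ h.1
    · exact lt_irrefl _ (hT _ _ h)
  have Btot : ∀ x y, x ≠ y → B x y ∨ B y x := by
    intro x y hxy
    rcases lt_or_gt_of_ne hxy with h | h
    · by_cases h' : (y, x) ∈ T
      · exact Or.inr (Or.inr h')
      · exact Or.inl (Or.inl ⟨h, h'⟩)
    · by_cases h' : (x, y) ∈ T
      · exact Or.inl (Or.inr h')
      · exact Or.inr (Or.inl ⟨h, h'⟩)
  have Btr : ∀ x y z, B x y → B y z → B x z := by
    rintro x y z (⟨h1, h2⟩ | h1) (⟨h3, h4⟩ | h3)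
    · exact Or.inl ⟨h1.trans h3, fun h => (hco x y z h1 h3 h).elim h4 h2⟩
    · have hzy := hT _ _ h3
      rcases lt_trichotomy x z with h | rfl | h
      · exact Or.inl ⟨h, fun h' => h2 (htr _ _ _ h3 h')⟩
      · exact absurd h3 h2
      · exact Or.inr ((hco z x y h h1 h3).resolve_left h2)
    · have hyx := hT _ _ h1
      rcases lt_trichotomy x z with h | rfl | h
      · exact Or.inl ⟨h, fun h' => h4 (htr _ _ _ h' h1)⟩
      · exact absurd h1 h4
      · exact Or.inr ((hco y z x h3 h h1).resolve_right h4)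
    · exact Or.inr (htr _ _ _ h1 h3)
  -- the position of the value `x` is the number of values before it
  let c : Fin n → ℕ := fun x => (Finset.univ.filter (fun y => B y x)).card
  have hmono : ∀ x y, B x y → c x < c y := by
    intro x y h
    apply Finset.card_lt_card
    rw [Finset.ssubset_iff_of_subset]
    · exact ⟨x, by simpa using h, by simpa using Birr x⟩
    · intro z hz
      simp only [Finset.mem_filter, Finset.mem_univ, true_and] at hz ⊢
      exact Btr _ _ _ hz h
  have hlt : ∀ x, c x < n := by
    intro x
    have h1 : c x < (Finset.univ : Finset (Fin n)).card := by
      apply Finset.card_lt_card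
      rw [Finset.ssubset_iff_of_subset (Finset.subset_univ _)]
      exact ⟨x, Finset.mem_univ _, by simpa using Birr x⟩
    simpa using h1
  let p : Fin n → Fin n := fun x => ⟨c x, hlt x⟩
  have hinj : Function.Injective p := by
    intro x y hxy
    by_contra hne
    have e : c x = c y := congrArg Fin.val hxy
    rcases Btot x y hne with h | h
    · exact absurd e (hmono _ _ h).ne
    · exact absurd e (hmono _ _ h).ne'
  let e : Equiv.Perm (Fin n) := Equiv.ofBijective p (Finite.injective_iff_bijective.1 hinj)
  have hiff : ∀ x y, p x < p y ↔ B x y := by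
    intro x y
    refine ⟨fun h => ?_, fun h => hmono _ _ h⟩
    have hne : x ≠ y := by rintro rfl; exact lt_irrefl _ h
    exact (Btot x y hne).resolve_right (fun h' => lt_asymm h (hmono _ _ h'))
  refine ⟨e.symm, ?_⟩
  ext ⟨b, a⟩
  rw [mem_inv]
  change a < b ∧ p b < p a ↔ _
  rw [hiff]
  constructor
  · rintro ⟨h, h' | h'⟩
    · exact absurd h'.1 (lt_asymm h)
    · exact h'
  · intro h
    exact ⟨hT _ _ h, Or.inr h⟩

theorem inv_trans (σ : Equiv.Perm (Fin n)) {a b c : Fin n} (h : (c, b) ∈ inv σ)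
    (h' : (b, a) ∈ inv σ) : (c, a) ∈ inv σ := by
  rw [mem_inv] at *
  exact ⟨h'.1.trans h.1, h.2.trans h'.2⟩

theorem inv_cotrans (σ : Equiv.Perm (Fin n)) {a b c : Fin n} (hab : a < b) (hbc : b < c)
    (h : (c, a) ∈ inv σ) : (c, b) ∈ inv σ ∨ (b, a) ∈ inv σ := by
  rw [mem_inv] at h
  rw [mem_inv, mem_inv]
  rcases lt_or_ge (σ.symm c) (σ.symm b) with h1 | h1
  · exact Or.inl ⟨hbc, h1⟩
  · exact Or.inr ⟨hab, h1.trans_lt h.2⟩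

theorem exists_isLUB (σ τ : Equiv.Perm (Fin n)) : ∃ ρ, IsLUB {σ, τ} ρ := by
  let R : Fin n → Fin n → Prop := fun x y => (x, y) ∈ inv σ ∨ (x, y) ∈ inv τ
  have hR : ∀ x y, R x y → y < x := by
    rintro x y (h | h)
    · exact (mem_inv.1 h).1
    · exact (mem_inv.1 h).1
  have hRco : ∀ a b c, a < b → b < c → R c a → R c b ∨ R b a := by
    rintro a b c hab hbc (h | h)
    · exact (inv_cotrans σ hab hbc h).imp Or.inl Or.inl
    · exact (inv_cotrans τ hab hbc h).imp Or.inr Or.inr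
  have hTlt : ∀ x y, Relation.TransGen R x y → y < x := by
    intro x y h
    induction h with
    | single h => exact hR _ _ h
    | tail _ h ih => exact (hR _ _ h).trans ih
  obtain ⟨ρ, hρ⟩ := exists_inv_eq {p : Fin n × Fin n | Relation.TransGen R p.1 p.2}
    (fun a b h => hTlt _ _ h) (fun a b c h h' => Relation.TransGen.trans h h') (by
      intro a b c hab hbc h
      change Relation.TransGen R c a at h
      change Relation.TransGen R c b ∨ Relation.TransGen R b a
      induction h with
      | single h =>
        exact (hRco _ _ _ hab hbc h).imp Relation.TransGen.single Relation.TransGen.single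
      | @tail d a hcd hda ih =>
        rcases lt_trichotomy d b with h | rfl | h
        · exact (ih h).imp id (fun h' => h'.tail hda)
        · exact Or.inl hcd
        · rcases hRco _ _ _ hab h hda with h' | h'
          · exact Or.inl (hcd.tail h')
          · exact Or.inr (Relation.TransGen.single h'))
  refine ⟨ρ, ?_, ?_⟩
  · rintro π (rfl | rfl)
    · rw [le_iff_inv, hρ]
      rintro ⟨x, y⟩ h
      exact Relation.TransGen.single (Or.inl h)
    · rw [le_iff_inv, hρ]
      rintro ⟨x, y⟩ h
      exact Relation.TransGen.single (Or.inr h)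
  · intro π hπ
    have h1 : inv σ ⊆ inv π := hπ (by simp)
    have h2 : inv τ ⊆ inv π := hπ (by simp)
    rw [le_iff_inv, hρ]
    rintro ⟨x, y⟩ h
    change Relation.TransGen R x y at h
    have hRπ : ∀ x y, R x y → (x, y) ∈ inv π := by
      rintro x y (h | h)
      · exact h1 h
      · exact h2 h
    induction h with
    | single h => exact hRπ _ _ h
    | tail _ h ih => exact inv_trans π ih (hRπ _ _ h)

/-- Composition with the longest permutation reverses the weak order. -/
theorem rev_le_rev {σ τ : Equiv.Perm (Fin n)} (h : σ ≤ τ) :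
    τ.trans Fin.revPerm ≤ σ.trans Fin.revPerm := by
  rw [le_iff_inv] at *
  rintro ⟨b, a⟩ hab
  rw [mem_inv] at *
  refine ⟨hab.1, ?_⟩
  have h1 : τ.symm b.rev < τ.symm a.rev := hab.2
  change σ.symm b.rev < σ.symm a.rev
  by_contra hcon
  have hlt : b.rev < a.rev := Fin.rev_lt_rev.2 hab.1
  have hne : σ.symm a.rev ≠ σ.symm b.rev := fun e => hlt.ne (σ.symm.injective e).symm
  have h2 : (a.rev, b.rev) ∈ inv τ := h (mem_inv.2 ⟨hlt, lt_of_le_of_ne (not_lt.1 hcon) hne⟩)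
  exact lt_asymm h1 (mem_inv.1 h2).2

theorem rev_rev (σ : Equiv.Perm (Fin n)) :
    (σ.trans Fin.revPerm).trans Fin.revPerm = σ := by
  ext i; simp

theorem exists_isGLB (σ τ : Equiv.Perm (Fin n)) : ∃ ρ, IsGLB {σ, τ} ρ := by
  obtain ⟨ρ, h1, h2⟩ := exists_isLUB (σ.trans Fin.revPerm) (τ.trans Fin.revPerm)
  refine ⟨ρ.trans Fin.revPerm, ?_, ?_⟩
  · rintro π (rfl | rfl)
    · have := rev_le_rev (h1 (Set.mem_insert _ _))
      rwa [rev_rev] at this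
    · have := rev_le_rev (h1 (Set.mem_insert_of_mem _ (Set.mem_singleton _)))
      rwa [rev_rev] at this
  · intro π hπ
    have h3 := rev_le_rev (h2 (a := π.trans Fin.revPerm) (by
      rintro _ (rfl | rfl)
      · exact rev_le_rev (hπ (by simp))
      · exact rev_le_rev (hπ (by simp))))
    rwa [rev_rev] at h3

/-- The weak order is a lattice. -/
noncomputable instance weakOrderLattice : Lattice (Equiv.Perm (Fin n)) :=
  { weakOrder with
    sup := fun σ τ => (exists_isLUB σ τ).choose
    le_sup_left := fun σ τ => (exists_isLUB σ τ).choose_spec.1 (by simp)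
    le_sup_right := fun σ τ => (exists_isLUB σ τ).choose_spec.1 (by simp)
    sup_le := fun σ τ ρ h h' => (exists_isLUB σ τ).choose_spec.2 (by
      rintro _ (rfl | rfl)
      · exact h
      · exact h')
    inf := fun σ τ => (exists_isGLB σ τ).choose
    inf_le_left := fun σ τ => (exists_isGLB σ τ).choose_spec.1 (by simp)
    inf_le_right := fun σ τ => (exists_isGLB σ τ).choose_spec.1 (by simp)
    le_inf := fun ρ σ τ h h' => (exists_isGLB σ τ).choose_spec.2 (by
      rintro _ (rfl | rfl)
      · exact h
      · exact h') }

/-- An arc `(a, b, n, S)`: `a < b` in `[n]` and `S ⊆ ]a, b[`. It is drawn from `a` to `b`, passing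
above the points of `S` and below the other points of `]a, b[`. -/
@[ext]
structure Arc (n : ℕ) where
  left : Fin n
  right : Fin n
  above : Set (Fin n)
  left_lt_right : left < right
  above_subset : above ⊆ Set.Ioo left right

/-- Two arcs `(a, b, n, R)` and `(c, d, n, S)` cross: among the points of `[a, b] ∩ [c, d]` that are
not a common endpoint, there are a point `r` where the first arc is above the second one (at `r`,
the first arc ends or passes above, the second one ends or passes below) and a point `s` where the
second arc is above the first one. -/
def Arc.Cross (α β : Arc n) : Prop :=
  ∃ r ∈ (Set.Icc α.left α.right ∩ Set.Icc β.left β.right) \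
      ({α.left, α.right} ∩ {β.left, β.right}),
  ∃ s ∈ (Set.Icc α.left α.right ∩ Set.Icc β.left β.right) \
      ({α.left, α.right} ∩ {β.left, β.right}),
    r ∈ (α.above ∪ {α.left, α.right}) \ β.above ∧ s ∈ (β.above ∪ {β.left, β.right}) \ α.above

/-- A noncrossing arc diagram: any two distinct arcs do not cross, have distinct left endpoints and
have distinct right endpoints. -/
def IsNoncrossingArcDiagram (D : Set (Arc n)) : Prop :=
  ∀ α ∈ D, ∀ β ∈ D, α ≠ β → ¬ α.Cross β ∧ α.left ≠ β.left ∧ α.right ≠ β.right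

/-- An arc ideal: a set of arcs containing, with `(a, d, n, S)`, all its restrictions
`(b, c, n, S ∩ ]b, c[)` for `a ≤ b < c ≤ d`. -/
def IsArcIdeal (I : Set (Arc n)) : Prop :=
  ∀ α ∈ I, ∀ β : Arc n, α.left ≤ β.left → β.right ≤ α.right →
    β.above = α.above ∩ Set.Ioo β.left β.right → β ∈ I

/-- The arc `α(i, j, σ) = (σ j, σ i, n, {σ k | k < i, σ k ∈ ]σ j, σ i[})`. -/
def arc (σ : Equiv.Perm (Fin n)) (i j : Fin n) (h : σ j < σ i) : Arc n where
  left := σ j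
  right := σ i
  above := {v | ∃ k : Fin n, k < i ∧ v = σ k} ∩ Set.Ioo (σ j) (σ i)
  left_lt_right := h
  above_subset := Set.inter_subset_right

/-- The set `δ(σ)` of the arcs of the descents of `σ`. -/
def descentArcs (σ : Equiv.Perm (Fin n)) : Set (Arc n) :=
  {α | ∃ i j : Fin n, (j : ℕ) = (i : ℕ) + 1 ∧ ∃ h : σ j < σ i, α = arc σ i j h}

/-- The bottom element `π↓(σ)` of the class of `σ` in a congruence of the weak order. -/
noncomputable def projDown (c : LatticeCon (Equiv.Perm (Fin n))) (σ : Equiv.Perm (Fin n)) :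
    Equiv.Perm (Fin n) :=
  open Classical in
  (Finset.univ.filter (fun τ => c.r σ τ)).inf' ⟨σ, by simp⟩ id

theorem isLeast_projDown (c : LatticeCon (Equiv.Perm (Fin n))) (σ : Equiv.Perm (Fin n)) :
    IsLeast {τ | c.r σ τ} (projDown c σ) := by
  classical
  constructor
  · refine Finset.inf'_induction (p := fun τ => c.r σ τ) _ _ ?_ ?_
    · intro τ h τ' h'
      simpa using c.inf h h'
    · intro τ h
      simpa using h
  · intro τ h
    exact Finset.inf'_le (f := id) (by simpa using h)

/-- The set `I` of a congruence: the arcs corresponding to the join-irreducible permutations `σ`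
not contracted by it, where `σ` corresponds to the arc of its unique descent. -/
def uncontractedArcs (c : LatticeCon (Equiv.Perm (Fin n))) : Set (Arc n) :=
  {α | ∃ σ : Equiv.Perm (Fin n), SupIrred σ ∧ projDown c σ = σ ∧ descentArcs σ = {α}}

/-- The noncrossing arc diagram `η(σ) = δ(π↓(σ))` of the congruence class of `σ`. -/
noncomputable def eta (c : LatticeCon (Equiv.Perm (Fin n))) (σ : Equiv.Perm (Fin n)) :
    Set (Arc n) :=
  descentArcs (projDown c σ)

/-- The empty-rectangle inversion pairs: positions `i < j` with `σ i > σ j` such that no position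
strictly between them has its value strictly between `σ j` and `σ i`. -/
def boxes (σ : Equiv.Perm (Fin n)) : Set (Fin n × Fin n) :=
  {p | p.1 < p.2 ∧ σ p.2 < σ p.1 ∧
    σ '' Set.Ioo p.1 p.2 ∩ Set.Ioo (σ p.2) (σ p.1) = ∅}

/-- The (reflexive) order `(i, j) ≺ (k, l)`: `i ≤ k < l ≤ j` and `σ k ≥ σ i > σ j ≥ σ l`. -/
def BoxLE (σ : Equiv.Perm (Fin n)) (p q : Fin n × Fin n) : Prop :=
  p.1 ≤ q.1 ∧ q.1 < q.2 ∧ q.2 ≤ p.2 ∧ σ p.1 ≤ σ q.1 ∧ σ p.2 < σ p.1 ∧ σ q.2 ≤ σ p.2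

/-- The empty-rectangle inversion pairs of `σ` whose arc lies in `I`. -/
def boxesIn (I : Set (Arc n)) (σ : Equiv.Perm (Fin n)) : Set (Fin n × Fin n) :=
  {p | p ∈ boxes σ ∧ ∃ h : σ p.2 < σ p.1, arc σ p.1 p.2 h ∈ I}

/-- The maximal elements of `boxesIn I σ`. -/
def maxBoxesIn (I : Set (Arc n)) (σ : Equiv.Perm (Fin n)) : Set (Fin n × Fin n) :=
  {p | p ∈ boxesIn I σ ∧ ∀ q ∈ boxesIn I σ, BoxLE σ p q → q = p}

end ArcDiagram

/-!
Two positions form an inversion whose rectangle is empty exactly when `σ` lies above the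
join-irreducible permutation `J(α)` of their arc `α` and the values passed by `α` stay outside the
positions in between. The minimum `τ = π↓(σ)` lies above the same `J(α)` with `α ∈ I` as `σ` does,
because `J(α)` is then the minimum of its own class. This gives `σ` and `τ` the same empty-rectangle
arcs in `I`: if `z` were a value on the wrong side in `σ`, an extremal choice of `z` would make
`J(β) ≤ σ` for a restriction `β` of `α`, hence `J(β) ≤ τ`, so that `z` would be on the wrong side
in `τ` as well. Moreover the order `≺` between two empty rectangles depends on their arcs only, so
`σ` and `τ` have the same maximal ones. Finally the maximal empty rectangles of any permutation are
its descents, and the descents of `τ` have their arcs in `I`: undoing a descent whose arc is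
contracted would give a smaller element of the class.

That `I` is an arc ideal comes from a permutation `ρ` with `J(α) ≤ J(β) ∨ ρ` and `J(α) ≰ ρ` which
lies above every permutation smaller than `J(β)`: contracting `J(β)` identifies `J(β) ∨ ρ` with `ρ`,
so `J(α)` is contracted as well.
-/

namespace ArcDiagram

variable {n : ℕ} {σ τ : Equiv.Perm (Fin n)} {α β : Arc n}

theorem notMem_inv {a b : Fin n} (h : a < b) : (b, a) ∉ inv σ ↔ σ.symm a < σ.symm b := by
  have hne : σ.symm a ≠ σ.symm b := σ.symm.injective.ne h.ne
  rw [mem_inv, not_and, not_lt]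
  exact ⟨fun h' => (h' h).lt_of_ne hne, fun h' _ => h'.le⟩

theorem symm_lt_symm_of_le (h : τ ≤ σ) {a b : Fin n} (hab : a < b)
    (hσ : σ.symm a < σ.symm b) : τ.symm a < τ.symm b :=
  (notMem_inv hab).1 fun hτ => (notMem_inv hab).2 hσ (le_iff_inv.1 h hτ)

theorem mem_inv_sort {γ : Type*} [LinearOrder γ] (f : Fin n → γ) {x y : Fin n} :
    (y, x) ∈ inv (Tuple.sort f) ↔ x < y ∧ f y < f x := by
  obtain ⟨hmono, hstable⟩ := Tuple.eq_sort_iff.1 (rfl : Tuple.sort f = Tuple.sort f)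
  rw [mem_inv]
  refine and_congr_right fun hxy => ⟨fun h => ?_, fun h => hmono.reflect_lt (by simpa using h)⟩
  have hle : f y ≤ f x := by simpa using hmono h.le
  refine hle.lt_of_ne fun heq => hxy.not_gt ?_
  simpa using hstable _ _ h (by simpa using heq)

theorem inv_trans_swap {a b : Fin n} (hab : a < b) (h : σ.symm b ⋖ σ.symm a) :
    inv (σ.trans (Equiv.swap a b)) = inv σ \ {(b, a)} := by
  have hpos : (σ.symm b : ℕ) + 1 = σ.symm a := by simpa using h
  have heq : ∀ u v : Fin n, (σ.symm u : ℕ) = σ.symm v → u = v :=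
    fun u v e => σ.symm.injective (Fin.ext e)
  ext ⟨y, x⟩
  simp only [Set.mem_sdiff, Set.mem_singleton_iff, Prod.mk.injEq, mem_inv, Equiv.symm_trans_apply,
    Equiv.symm_swap, Equiv.swap_apply_def, Fin.lt_def]
  grind

/-- Since `τ ≤ σ`, the ascents of `σ` are ordered in `τ` as in `σ`. So are its descents by
assumption, hence `τ⁻¹ ∘ σ` is increasing. -/
theorem eq_of_le_of_descents_mem_inv (hτ : τ ≤ σ)
    (h : ∀ i j, i ⋖ j → σ j < σ i → (σ i, σ j) ∈ inv τ) : τ = σ := by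
  have hmono : StrictMono fun i => τ.symm (σ i) := by
    refine strictMono_iff_forall_covBy _ |>.2 fun i j hij => ?_
    rcases lt_or_gt_of_ne (σ.injective.ne hij.lt.ne) with hasc | hdesc
    · exact symm_lt_symm_of_le hτ hasc (by simpa using hij.lt)
    · exact (mem_inv.1 (h i j hij hdesc)).2
  refine le_antisymm hτ (le_iff_inv.2 ?_)
  rintro _ ⟨i, j, hij, hlt, rfl⟩
  exact mem_inv.2 ⟨hlt, hmono hij⟩

namespace Arc

/-- The points of `[left, right]` where the arc is on the upper side: those it passes above,
together with its right endpoint. In a box with this arc they are not after the value `right`. -/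
def upper (α : Arc n) : Set (Fin n) := insert α.right α.above

/-- The points of `[left, right]` where the arc is on the lower side: those it passes below,
together with its left endpoint. In a box with this arc they are not before the value `left`. -/
def lower (α : Arc n) : Set (Fin n) := insert α.left (Set.Ioo α.left α.right \ α.above)

theorem mem_upper {v : Fin n} : v ∈ α.upper ↔ v = α.right ∨ v ∈ α.above := Iff.rfl

theorem mem_lower {v : Fin n} :
    v ∈ α.lower ↔ v = α.left ∨ v ∈ Set.Ioo α.left α.right ∧ v ∉ α.above := Iff.rfl

theorem right_mem_upper (α : Arc n) : α.right ∈ α.upper := Or.inl rfl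

theorem left_mem_lower (α : Arc n) : α.left ∈ α.lower := Or.inl rfl

theorem upper_subset_Ioc (α : Arc n) : α.upper ⊆ Set.Ioc α.left α.right :=
  Set.insert_subset ⟨α.left_lt_right, le_rfl⟩ (α.above_subset.trans Set.Ioo_subset_Ioc_self)

theorem lower_subset_Ico (α : Arc n) : α.lower ⊆ Set.Ico α.left α.right :=
  Set.insert_subset ⟨le_rfl, α.left_lt_right⟩
    (Set.sdiff_subset.trans Set.Ioo_subset_Ico_self)

theorem upper_union_lower (α : Arc n) : α.upper ∪ α.lower = Set.Icc α.left α.right := by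
  ext v
  have := α.left_lt_right
  have := @α.above_subset v
  simp only [Set.mem_union, mem_upper, mem_lower, Set.mem_Ioo, Set.mem_Icc] at *
  grind

theorem above_eq_upper_sdiff (α : Arc n) : α.above = α.upper \ {α.right} := by
  ext v
  have := @α.above_subset v
  simp only [Set.mem_sdiff, mem_upper, Set.mem_Ioo, Set.mem_singleton_iff] at *
  grind

/-- The arc `(a, b, n, S ∩ ]a, b[)`. -/
def restrict (α : Arc n) {a b : Fin n} (h : a < b) : Arc n where
  left := a
  right := b
  above := α.above ∩ Set.Ioo a b
  left_lt_right := h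
  above_subset := Set.inter_subset_right

/-- The order `≺` between two boxes of a permutation, expressed by their arcs. -/
def BoxLE (α β : Arc n) : Prop := α.left ∈ β.lower ∧ α.right ∈ β.upper

theorem Cross.symm (h : α.Cross β) : β.Cross α := by
  obtain ⟨r, hr, s, hs, hrα, hsβ⟩ := h
  rw [Set.inter_comm, Set.inter_comm {_, _}] at hr hs
  exact ⟨s, hs, r, hr, hsβ, hrα⟩

end Arc

/-- `α` is the arc of a box of `σ`, that is, of an empty-rectangle inversion pair of positions. -/
structure IsBoxArc (σ : Equiv.Perm (Fin n)) (α : Arc n) : Prop where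
  right_lt_left : σ.symm α.right < σ.symm α.left
  le_right : ∀ y ∈ α.upper, σ.symm y ≤ σ.symm α.right
  left_le : ∀ x ∈ α.lower, σ.symm α.left ≤ σ.symm x

namespace IsBoxArc

theorem lt (h : IsBoxArc σ α) {x y : Fin n} (hy : y ∈ α.upper) (hx : x ∈ α.lower) :
    σ.symm y < σ.symm x :=
  (h.le_right y hy).trans_lt (h.right_lt_left.trans_le (h.left_le x hx))

theorem mem_upper_iff (h : IsBoxArc σ α) {v : Fin n} (hv : v ∈ Set.Icc α.left α.right) :
    v ∈ α.upper ↔ σ.symm v ≤ σ.symm α.right := by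
  refine ⟨h.le_right v, fun hle => ?_⟩
  rw [← α.upper_union_lower] at hv
  exact hv.resolve_right fun hv => (h.lt α.right_mem_upper hv).not_ge hle

theorem mem_lower_iff (h : IsBoxArc σ α) {v : Fin n} (hv : v ∈ Set.Icc α.left α.right) :
    v ∈ α.lower ↔ σ.symm α.left ≤ σ.symm v := by
  refine ⟨h.left_le v, fun hle => ?_⟩
  rw [← α.upper_union_lower] at hv
  exact hv.resolve_left fun hv => (h.lt hv α.left_mem_lower).not_ge hle

theorem eq_of_endpoints_eq (hα : IsBoxArc σ α) (hβ : IsBoxArc σ β) (hleft : α.left = β.left)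
    (hright : α.right = β.right) : α = β := by
  have hupper : α.upper = β.upper := by
    ext v
    by_cases hv : v ∈ Set.Icc α.left α.right
    · rw [hα.mem_upper_iff hv, hβ.mem_upper_iff (hleft ▸ hright ▸ hv), hright]
    · have hvβ : v ∉ Set.Icc β.left β.right := hleft ▸ hright ▸ hv
      exact iff_of_false (fun h => hv (Set.Ioc_subset_Icc_self (α.upper_subset_Ioc h)))
        fun h => hvβ (Set.Ioc_subset_Icc_self (β.upper_subset_Ioc h))
  refine Arc.ext hleft hright ?_
  rw [α.above_eq_upper_sdiff, β.above_eq_upper_sdiff, hupper, hright]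

theorem boxLE_iff (hβ : IsBoxArc σ β) :
    BoxLE σ (σ.symm α.right, σ.symm α.left) (σ.symm β.right, σ.symm β.left) ↔ α.BoxLE β := by
  have hlt := α.left_lt_right
  constructor
  · rintro ⟨hright, -, hleft, hright', -, hleft'⟩
    simp only [Equiv.apply_symm_apply] at hright' hleft'
    exact ⟨(hβ.mem_lower_iff ⟨hleft', hlt.le.trans hright'⟩).2 hleft,
      (hβ.mem_upper_iff ⟨hleft'.trans hlt.le, hright'⟩).2 hright⟩
  · rintro ⟨hleft, hright⟩
    refine ⟨hβ.le_right _ hright, hβ.right_lt_left, hβ.left_le _ hleft, ?_, ?_, ?_⟩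
    · simpa using (β.upper_subset_Ioc hright).2
    · simpa using hlt
    · simpa using (β.lower_subset_Ico hleft).1

theorem mem_boxes (h : IsBoxArc σ α) : (σ.symm α.right, σ.symm α.left) ∈ boxes σ := by
  refine ⟨h.right_lt_left, by simpa using α.left_lt_right,
    Set.eq_empty_iff_forall_notMem.2 ?_⟩
  rintro _ ⟨⟨k, ⟨hright, hleft⟩, rfl⟩, hk⟩
  simp only [Equiv.apply_symm_apply] at hk
  have hmem : σ k ∈ α.upper ∪ α.lower := α.upper_union_lower ▸ Set.Ioo_subset_Icc_self hk
  rcases hmem with hmem | hmem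
  · exact hright.not_ge (by simpa using h.le_right _ hmem)
  · exact hleft.not_ge (by simpa using h.left_le _ hmem)

end IsBoxArc

theorem isBoxArc_arc {i j : Fin n} (hbox : (i, j) ∈ boxes σ) (h : σ j < σ i) :
    IsBoxArc σ (arc σ i j h) := by
  obtain ⟨hij, -, hempty⟩ := hbox
  constructor
  · simpa [arc] using hij
  · rintro y (rfl | ⟨⟨k, hk, rfl⟩, -⟩)
    · exact le_rfl
    · simpa [arc] using hk.le
  · rintro x (rfl | ⟨hx, hnot⟩)
    · exact le_rfl
    have hle : i ≤ σ.symm x := not_lt.1 fun hlt => hnot ⟨⟨_, hlt, by simp⟩, hx⟩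
    have hne : i ≠ σ.symm x := by
      rintro rfl
      exact hx.2.ne (by simp [arc])
    by_contra! hlt
    have hmem : x ∈ σ '' Set.Ioo i j ∩ Set.Ioo (σ j) (σ i) :=
      ⟨⟨_, ⟨hle.lt_of_ne hne, by simpa [arc] using hlt⟩, by simp⟩, hx⟩
    exact (Set.eq_empty_iff_forall_notMem.1 hempty x) hmem

theorem IsBoxArc.exists_eq_arc (h : IsBoxArc σ α) :
    ∃ hlt, α = arc σ (σ.symm α.right) (σ.symm α.left) hlt := by
  have hlt : σ (σ.symm α.left) < σ (σ.symm α.right) := by simpa using α.left_lt_right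
  exact ⟨hlt, h.eq_of_endpoints_eq (isBoxArc_arc h.mem_boxes hlt) (by simp [arc]) (by simp [arc])⟩

theorem mem_boxes_of_covBy {i j : Fin n} (hij : i ⋖ j) (h : σ j < σ i) : (i, j) ∈ boxes σ :=
  ⟨hij.lt, h, by simp [hij.Ioo_eq]⟩

theorem arc_mem_descentArcs {i j : Fin n} (hij : i ⋖ j) (h : σ j < σ i) :
    arc σ i j h ∈ descentArcs σ := by
  have hsucc : (i : ℕ) + 1 = j := by simpa using hij
  exact ⟨i, j, hsucc.symm, h, rfl⟩

theorem mem_descentArcs :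
    α ∈ descentArcs σ ↔ IsBoxArc σ α ∧ σ.symm α.right ⋖ σ.symm α.left := by
  constructor
  · rintro ⟨i, j, hsucc, h, rfl⟩
    have hij : i ⋖ j := by simp [hsucc]
    exact ⟨isBoxArc_arc (mem_boxes_of_covBy hij h) h, by simpa [arc] using hij⟩
  · rintro ⟨hbox, hcov⟩
    obtain ⟨h, heq⟩ := hbox.exists_eq_arc
    rw [heq]
    exact arc_mem_descentArcs hcov h

theorem eq_of_le_of_descentArcs_mem_inv (hτ : τ ≤ σ)
    (h : ∀ α ∈ descentArcs σ, (α.right, α.left) ∈ inv τ) : τ = σ :=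
  eq_of_le_of_descents_mem_inv hτ fun _ _ hij hlt => h _ (arc_mem_descentArcs hij hlt)

theorem inv_trans_swap_of_mem_descentArcs (h : α ∈ descentArcs σ) :
    inv (σ.trans (Equiv.swap α.left α.right)) = inv σ \ {(α.right, α.left)} :=
  inv_trans_swap α.left_lt_right (mem_descentArcs.1 h).2

/-- At a common point where `α` is above `β`, the value comes weakly before `α.left` and weakly
after `β.right`, so by the assumption it is both. -/
theorem IsBoxArc.not_cross (hα : IsBoxArc σ α) (hβ : IsBoxArc σ β)
    (h : σ.symm α.left ≤ σ.symm β.right) : ¬ α.Cross β := by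
  rintro ⟨r, ⟨⟨-, hrβ⟩, hne⟩, -, -, ⟨hαr, hβr⟩, -⟩
  have hleft : σ.symm r ≤ σ.symm α.left := by
    rcases hαr with hr | rfl | rfl
    · exact (hα.lt (Or.inr hr) α.left_mem_lower).le
    · exact le_rfl
    · exact hα.right_lt_left.le
  have hright : σ.symm β.right ≤ σ.symm r := by
    rw [← β.upper_union_lower] at hrβ
    rcases hrβ with (rfl | hr) | hr
    · exact le_rfl
    · exact absurd hr hβr
    · exact (hβ.lt β.right_mem_upper hr).le
  have hrα : r = α.left := σ.symm.injective (hleft.antisymm (h.trans hright))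
  have hrβ' : r = β.right := σ.symm.injective ((hleft.trans h).antisymm hright)
  exact hne ⟨Or.inl hrα, Or.inr hrβ'⟩

theorem isNoncrossingArcDiagram_descentArcs (σ : Equiv.Perm (Fin n)) :
    IsNoncrossingArcDiagram (descentArcs σ) := by
  intro α hα β hβ hne
  obtain ⟨hboxα, hcovα⟩ := mem_descentArcs.1 hα
  obtain ⟨hboxβ, hcovβ⟩ := mem_descentArcs.1 hβ
  have hright : α.right ≠ β.right := fun h =>
    hne (hboxα.eq_of_endpoints_eq hboxβ (σ.symm.injective (hcovα.unique_right (h ▸ hcovβ))) h)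
  have hleft : α.left ≠ β.left := fun h =>
    hright (σ.symm.injective (hcovα.unique_left (h ▸ hcovβ)))
  refine ⟨?_, hleft, hright⟩
  rcases lt_or_gt_of_ne (σ.symm.injective.ne hright) with hlt | hlt
  · exact hboxα.not_cross hboxβ (hcovα.ge_of_gt hlt)
  · exact fun h => hboxβ.not_cross hboxα (hcovβ.ge_of_gt hlt) h.symm

theorem exists_covBy_of_lt_of_not {γ : Type*} [LinearOrder γ] [LocallyFiniteOrder γ]
    {p : γ → Prop} {i j : γ} (hij : i < j) (hi : p i) (hj : ¬ p j) :
    ∃ k l, i ≤ k ∧ k ⋖ l ∧ l ≤ j ∧ p k ∧ ¬ p l := by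
  obtain ⟨k, ⟨⟨hik, hkj⟩, hk⟩, hmax⟩ :=
    ((Set.finite_Icc i j).inter_of_left {k | p k}).exists_maximal ⟨i, ⟨le_rfl, hij.le⟩, hi⟩
  obtain ⟨l, hkl, hlj⟩ := exists_covBy_le_of_lt (hkj.lt_of_ne fun h => hj (h ▸ hk))
  exact ⟨k, l, hik, hkl, hlj, hk, fun hl =>
    hkl.lt.not_ge (hmax ⟨⟨hik.trans hkl.le, hlj⟩, hl⟩ hkl.le)⟩

/-- Read from left to right, the values of a box jump from above its range to below it. -/
theorem IsBoxArc.exists_boxLE_mem_descentArcs (hα : IsBoxArc σ α) :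
    ∃ β ∈ descentArcs σ, α.BoxLE β := by
  obtain ⟨i, j, hright, hij, hleft, hi, hj⟩ :=
    exists_covBy_of_lt_of_not (p := fun k => α.right ≤ σ k) hα.right_lt_left (by simp)
      (by simpa using α.left_lt_right)
  have hjle : σ j ≤ α.left := by
    by_contra! hlt
    have hmem : σ j ∈ α.upper ∪ α.lower := α.upper_union_lower ▸ ⟨hlt.le, (not_le.1 hj).le⟩
    rcases hmem with hmem | hmem
    · exact (hright.trans_lt hij.lt).not_ge (by simpa using hα.le_right _ hmem)
    · have : j = σ.symm α.left := hleft.antisymm (by simpa using hα.left_le _ hmem)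
      simp [this] at hlt
  have hlt : σ j < σ i := hjle.trans_lt (α.left_lt_right.trans_le hi)
  have hbox := isBoxArc_arc (mem_boxes_of_covBy hij hlt) hlt
  refine ⟨_, arc_mem_descentArcs hij hlt, hbox.boxLE_iff.1 ?_⟩
  exact ⟨by simpa [arc] using hright, hbox.right_lt_left, by simpa [arc] using hleft,
    by simpa [arc] using hi, by simpa using α.left_lt_right, by simpa [arc] using hjle⟩

theorem eq_of_mem_descentArcs_of_boxLE (hα : α ∈ descentArcs σ) (hβ : IsBoxArc σ β)
    (h : α.BoxLE β) : β = α := by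
  obtain ⟨hbox, hcov⟩ := mem_descentArcs.1 hα
  have hright : σ.symm β.right = σ.symm α.right :=
    (hcov.le_of_lt (hβ.lt β.right_mem_upper h.1)).antisymm (hβ.le_right _ h.2)
  have hleft : σ.symm β.left = σ.symm α.left :=
    (hβ.left_le _ h.1).antisymm (hcov.ge_of_gt (hright ▸ hβ.right_lt_left))
  exact hβ.eq_of_endpoints_eq hbox (σ.symm.injective hleft) (σ.symm.injective hright)

/-- The `≺`-maximal arcs of a set of arcs. -/
def maxArcs (A : Set (Arc n)) : Set (Arc n) := {α ∈ A | ∀ β ∈ A, α.BoxLE β → β = α}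

theorem descentArcs_eq_maxArcs {I : Set (Arc n)} (hI : descentArcs σ ⊆ I) :
    descentArcs σ = maxArcs {α ∈ I | IsBoxArc σ α} := by
  ext α
  constructor
  · intro hα
    exact ⟨⟨hI hα, (mem_descentArcs.1 hα).1⟩,
      fun β hβ hle => eq_of_mem_descentArcs_of_boxLE hα hβ.2 hle⟩
  · rintro ⟨⟨-, hα⟩, hmax⟩
    obtain ⟨β, hβ, hle⟩ := hα.exists_boxLE_mem_descentArcs
    rwa [← hmax β ⟨hI hβ, (mem_descentArcs.1 hβ).1⟩ hle]

theorem mem_boxesIn {I : Set (Arc n)} {i j : Fin n} :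
    (i, j) ∈ boxesIn I σ ↔ ∃ α ∈ I, IsBoxArc σ α ∧ (σ.symm α.right, σ.symm α.left) = (i, j) := by
  constructor
  · rintro ⟨hbox, h, hI⟩
    exact ⟨_, hI, isBoxArc_arc hbox h, by simp [arc]⟩
  · rintro ⟨α, hI, hα, heq⟩
    obtain ⟨h, hα'⟩ := hα.exists_eq_arc
    rw [← heq]
    exact ⟨hα.mem_boxes, h, hα' ▸ hI⟩

theorem setOf_arc_maxBoxesIn (I : Set (Arc n)) (σ : Equiv.Perm (Fin n)) :
    {α | ∃ i j, (i, j) ∈ maxBoxesIn I σ ∧ ∃ h : σ j < σ i, α = arc σ i j h} =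
      maxArcs {α ∈ I | IsBoxArc σ α} := by
  ext α
  constructor
  · rintro ⟨i, j, ⟨⟨hbox, _, hI⟩, hmax⟩, h, rfl⟩
    have hα := isBoxArc_arc hbox h
    refine ⟨⟨hI, hα⟩, fun β ⟨hβI, hβ⟩ hle => ?_⟩
    have heq := hmax _ (mem_boxesIn.2 ⟨β, hβI, hβ, rfl⟩)
      (by simpa [arc] using hβ.boxLE_iff.2 hle)
    obtain ⟨hright, hleft⟩ := Prod.mk.inj heq
    exact hβ.eq_of_endpoints_eq hα (by simp [arc, ← hleft]) (by simp [arc, ← hright])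
  · rintro ⟨⟨hI, hα⟩, hmax⟩
    refine ⟨_, _, ⟨mem_boxesIn.2 ⟨α, hI, hα, rfl⟩, fun ⟨i, j⟩ hij hle => ?_⟩, hα.exists_eq_arc⟩
    obtain ⟨β, hβI, hβ, heq⟩ := mem_boxesIn.1 hij
    rw [← heq] at hle ⊢
    rw [hmax β ⟨hβI, hβ⟩ (hβ.boxLE_iff.1 hle)]

open Classical in
/-- The permutation listing first the values below `α.left` or in `α.upper`, then the other
values, both in increasing order. It is the join-irreducible permutation with the arc `α`. -/
noncomputable def joinIrred (α : Arc n) : Equiv.Perm (Fin n) :=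
  Tuple.sort fun v => if v < α.left ∨ v ∈ α.upper then 0 else 1

theorem mem_inv_joinIrred {x y : Fin n} :
    (y, x) ∈ inv (joinIrred α) ↔ x < y ∧ y ∈ α.upper ∧ x ∈ α.lower := by
  have hlt := α.left_lt_right
  have hy := @α.above_subset y
  have hx := @α.above_subset x
  rw [Set.mem_Ioo] at hx hy
  rw [joinIrred, mem_inv_sort]
  grind [Arc.mem_upper, Arc.mem_lower]

theorem right_left_mem_inv_joinIrred (α : Arc n) : (α.right, α.left) ∈ inv (joinIrred α) :=
  mem_inv_joinIrred.2 ⟨α.left_lt_right, α.right_mem_upper, α.left_mem_lower⟩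

theorem joinIrred_le_iff :
    joinIrred α ≤ σ ↔ ∀ y ∈ α.upper, ∀ x ∈ α.lower, x < y → σ.symm y < σ.symm x := by
  rw [le_iff_inv]
  exact ⟨fun h y hy x hx hlt => (mem_inv.1 (h (mem_inv_joinIrred.2 ⟨hlt, hy, hx⟩))).2,
    fun h ⟨y, x⟩ hyx =>
      let ⟨hlt, hy, hx⟩ := mem_inv_joinIrred.1 hyx
      mem_inv.2 ⟨hlt, h y hy x hx hlt⟩⟩

theorem IsBoxArc.joinIrred_le (h : IsBoxArc σ α) : joinIrred α ≤ σ :=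
  joinIrred_le_iff.2 fun _ hy _ hx _ => h.lt hy hx

theorem isBoxArc_joinIrred (α : Arc n) : IsBoxArc (joinIrred α) α := by
  refine ⟨(mem_inv.1 (right_left_mem_inv_joinIrred α)).2, ?_, ?_⟩
  · rintro y (rfl | hy)
    · exact le_rfl
    refine ((notMem_inv (α.above_subset hy).2).1 fun hmem => ?_).le
    rcases (mem_inv_joinIrred.1 hmem).2.2 with rfl | hy'
    · exact (α.above_subset hy).1.false
    · exact hy'.2 hy
  · rintro x (rfl | hx)
    · exact le_rfl
    refine ((notMem_inv hx.1.1).1 fun hmem => ?_).le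
    rcases (mem_inv_joinIrred.1 hmem).2.1 with rfl | hx'
    · exact hx.1.2.false
    · exact hx.2 hx'

theorem descentArcs_joinIrred (α : Arc n) : descentArcs (joinIrred α) = {α} := by
  have hα := isBoxArc_joinIrred α
  have hsub : descentArcs (joinIrred α) ⊆ {α} := by
    intro β hβ
    obtain ⟨hboxβ, -⟩ := mem_descentArcs.1 hβ
    obtain ⟨-, hright, hleft⟩ :=
      mem_inv_joinIrred.1 (mem_inv.2 ⟨β.left_lt_right, hboxβ.right_lt_left⟩)
    exact (eq_of_mem_descentArcs_of_boxLE hβ hα ⟨hleft, hright⟩).symm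
  obtain ⟨β, hβ, -⟩ := hα.exists_boxLE_mem_descentArcs
  exact hsub.antisymm (Set.singleton_subset_iff.2 (hsub hβ ▸ hβ))

theorem joinIrred_eq_of_le_of_mem_inv (h : τ ≤ joinIrred α) (hmem : (α.right, α.left) ∈ inv τ) :
    τ = joinIrred α :=
  eq_of_le_of_descentArcs_mem_inv h fun β hβ => by
    rw [descentArcs_joinIrred, Set.mem_singleton_iff] at hβ
    rwa [hβ]

theorem joinIrred_eq_of_descentArcs_eq (h : descentArcs σ = {α}) : joinIrred α = σ := by
  have hα : IsBoxArc σ α := (mem_descentArcs.1 (h ▸ rfl)).1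
  refine eq_of_le_of_descentArcs_mem_inv hα.joinIrred_le fun β hβ => ?_
  rw [h, Set.mem_singleton_iff] at hβ
  exact hβ ▸ right_left_mem_inv_joinIrred α

theorem supIrred_of_forall_lt_le {γ : Type*} [SemilatticeSup γ] {a u : γ} (hu : u < a)
    (h : ∀ b < a, b ≤ u) : SupIrred a := by
  refine ⟨fun hmin => hmin.not_lt hu, fun {b d} hbd => ?_⟩
  by_contra! hne
  have hb : b < a := (hbd ▸ le_sup_left).lt_of_ne hne.1
  have hd : d < a := (hbd ▸ le_sup_right).lt_of_ne hne.2
  exact hu.not_ge (hbd ▸ sup_le (h b hb) (h d hd))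

theorem supIrred_joinIrred (α : Arc n) : SupIrred (joinIrred α) := by
  have hmem : α ∈ descentArcs (joinIrred α) := by rw [descentArcs_joinIrred]; rfl
  have hinv := inv_trans_swap_of_mem_descentArcs hmem
  refine supIrred_of_forall_lt_le (u := (joinIrred α).trans (Equiv.swap α.left α.right))
    (lt_of_le_not_ge ?_ ?_) fun τ hτ => ?_
  · exact le_iff_inv.2 (hinv ▸ Set.sdiff_subset)
  · exact fun hle => (hinv ▸ le_iff_inv.1 hle (right_left_mem_inv_joinIrred α)).2 rfl
  · rw [le_iff_inv, hinv]
    refine Set.subset_sdiff_singleton (le_iff_inv.1 hτ.le) fun hmem => ?_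
    exact hτ.ne (joinIrred_eq_of_le_of_mem_inv hτ.le hmem)

open Classical in
/-- With `α = (a, d, n, S)` and `Q = ]a, d[ \ S`, this permutation lists the values of `[a, d]` in
the order `S b a d c Q`, where `b` and `c` are taken out of `S` or `Q`; here `b = a` and `c = d` are
allowed. Once `c` has to precede `b`, transitivity forces `d` to precede `a`. -/
noncomputable def pivot (α : Arc n) (b c : Fin n) : Equiv.Perm (Fin n) :=
  Tuple.sort fun v => if v = α.left then 2 else if v = α.right then 3 else if v = b then 1
    else if v = c then 4 else if v ∈ α.above then 0 else 5

section Pivot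

variable {b c : Fin n}

theorem inv_joinIrred_restrict_subset_inv_pivot (hb : α.left ≤ b) (hbc : b < c)
    (hc : c ≤ α.right) : inv (joinIrred (α.restrict hbc)) \ {(c, b)} ⊆ inv (pivot α b c) := by
  rintro ⟨y, x⟩ ⟨hyx, hne⟩
  simp only [mem_inv_joinIrred, Arc.mem_upper, Arc.mem_lower, Arc.restrict, Set.mem_inter_iff,
    Set.mem_Ioo, Set.mem_singleton_iff, Prod.mk.injEq, pivot, mem_inv_sort] at hyx hne ⊢
  grind

theorem right_left_notMem_inv_pivot (α : Arc n) (b c : Fin n) :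
    (α.right, α.left) ∉ inv (pivot α b c) := by
  simp [pivot, mem_inv_sort, α.left_lt_right.ne']

theorem mem_inv_pivot_of_mem_inv_joinIrred (hbc : b < c) {x y : Fin n}
    (h : (y, x) ∈ inv (joinIrred α)) :
    (y, x) ∈ inv (pivot α b c) ∨ (y = c ∨ y = α.right) ∧ (x = b ∨ x = α.left) := by
  have hy := @α.above_subset y
  have hx := @α.above_subset x
  simp only [mem_inv_joinIrred, Arc.mem_upper, Arc.mem_lower, Set.mem_Ioo, pivot,
    mem_inv_sort] at h hx hy ⊢
  grind

theorem joinIrred_le_joinIrred_restrict_sup_pivot (hb : α.left ≤ b) (hbc : b < c)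
    (hc : c ≤ α.right) : joinIrred α ≤ joinIrred (α.restrict hbc) ⊔ pivot α b c := by
  set ρ := joinIrred (α.restrict hbc) ⊔ pivot α b c
  have hpivot : inv (pivot α b c) ⊆ inv ρ := le_iff_inv.1 le_sup_right
  have hcb : (c, b) ∈ inv ρ :=
    le_iff_inv.1 le_sup_left (right_left_mem_inv_joinIrred (α.restrict hbc))
  have hright : c = α.right ∨ (α.right, c) ∈ inv ρ := by
    refine hc.eq_or_lt.imp_right fun hlt => hpivot ?_
    simp only [pivot, mem_inv_sort]
    grind
  have hleft : b = α.left ∨ (b, α.left) ∈ inv ρ := by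
    refine hb.eq_or_lt.imp Eq.symm fun hlt => hpivot ?_
    simp only [pivot, mem_inv_sort]
    grind
  have hleft' : ∀ y, (y, b) ∈ inv ρ → (y, α.left) ∈ inv ρ := fun y hy =>
    hleft.elim (fun h => h ▸ hy) (inv_trans ρ hy)
  have hright' : ∀ x, (c, x) ∈ inv ρ → (α.right, x) ∈ inv ρ := fun x hx =>
    hright.elim (fun h => h ▸ hx) fun h => inv_trans ρ h hx
  refine le_iff_inv.2 fun ⟨y, x⟩ hyx => ?_
  rcases mem_inv_pivot_of_mem_inv_joinIrred hbc hyx with h | ⟨rfl | rfl, rfl | rfl⟩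
  · exact hpivot h
  · exact hcb
  · exact hleft' _ hcb
  · exact hright' _ hcb
  · exact hright' _ (hleft' _ hcb)

end Pivot

theorem exists_joinIrred_restrict_right_le (h : joinIrred α ≤ σ) {y : Fin n} (hy : y ∈ α.upper)
    (hlt : σ.symm α.right < σ.symm y) :
    ∃ z ∈ α.upper, ∃ hz : z < α.right, joinIrred (α.restrict hz) ≤ σ := by
  obtain ⟨z, hz⟩ :=
    (Set.toFinite {z | z ∈ α.upper ∧ σ.symm α.right < σ.symm z}).exists_maximal ⟨y, hy, hlt⟩
  have hzr : z < α.right := lt_of_le_of_ne (α.upper_subset_Ioc hz.1.1).2 fun heq =>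
    hz.1.2.ne (heq ▸ rfl)
  refine ⟨z, hz.1.1, hzr, joinIrred_le_iff.2 fun u hu v hv _ => ?_⟩
  have hu' : σ.symm u ≤ σ.symm α.right := by
    rcases hu with rfl | ⟨hu, hzu, -⟩
    · exact le_rfl
    · exact not_lt.1 fun hru => hz.not_gt ⟨Or.inr hu, hru⟩ hzu
  refine hu'.trans_lt ?_
  rcases hv with rfl | ⟨⟨hzv, hvr⟩, hv⟩
  · exact hz.1.2
  · have hv' : v ∈ α.lower :=
      Or.inr ⟨⟨(α.upper_subset_Ioc hz.1.1).1.trans hzv, hvr⟩, fun hmem => hv ⟨hmem, hzv, hvr⟩⟩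
    exact joinIrred_le_iff.1 h _ α.right_mem_upper _ hv' hvr

theorem exists_joinIrred_restrict_left_le (h : joinIrred α ≤ σ) {x : Fin n} (hx : x ∈ α.lower)
    (hlt : σ.symm x < σ.symm α.left) :
    ∃ z ∈ α.lower, ∃ hz : α.left < z, joinIrred (α.restrict hz) ≤ σ := by
  obtain ⟨z, hz⟩ :=
    (Set.toFinite {z | z ∈ α.lower ∧ σ.symm z < σ.symm α.left}).exists_minimal ⟨x, hx, hlt⟩
  have hlz : α.left < z := lt_of_le_of_ne (α.lower_subset_Ico hz.1.1).1 fun heq =>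
    hz.1.2.ne (heq ▸ rfl)
  refine ⟨z, hz.1.1, hlz, joinIrred_le_iff.2 fun u hu v hv _ => ?_⟩
  have hv' : σ.symm α.left ≤ σ.symm v := by
    rcases hv with rfl | ⟨⟨hlv, hvz⟩, hv⟩
    · exact le_rfl
    · have hmem : v ∈ α.lower :=
        Or.inr ⟨⟨hlv, hvz.trans (α.lower_subset_Ico hz.1.1).2⟩, fun hmem => hv ⟨hmem, hlv, hvz⟩⟩
      exact not_lt.1 fun hvl => hz.not_lt ⟨hmem, hvl⟩ hvz
  refine lt_of_lt_of_le ?_ hv'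
  rcases hu with rfl | ⟨hu, hlu, -⟩
  · exact hz.1.2
  · exact joinIrred_le_iff.1 h _ (Or.inr hu) _ α.left_mem_lower hlu

variable {c : LatticeCon (Equiv.Perm (Fin n))}

theorem rel_projDown (c : LatticeCon (Equiv.Perm (Fin n))) (σ : Equiv.Perm (Fin n)) :
    c.r σ (projDown c σ) := (isLeast_projDown c σ).1

theorem projDown_le (c : LatticeCon (Equiv.Perm (Fin n))) (σ : Equiv.Perm (Fin n)) :
    projDown c σ ≤ σ := (isLeast_projDown c σ).2 (c.refl σ)

theorem projDown_projDown (c : LatticeCon (Equiv.Perm (Fin n))) (σ : Equiv.Perm (Fin n)) :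
    projDown c (projDown c σ) = projDown c σ :=
  le_antisymm (projDown_le c _)
    ((isLeast_projDown c σ).2 (c.trans (rel_projDown c σ) (rel_projDown c _)))

theorem projDown_mono (h : σ ≤ τ) : projDown c σ ≤ projDown c τ := by
  have hrel := c.inf (rel_projDown c σ) (rel_projDown c τ)
  rw [inf_eq_left.2 h] at hrel
  exact ((isLeast_projDown c σ).2 hrel).trans inf_le_right

theorem projDown_le_of_le_sup {ρ : Equiv.Perm (Fin n)} (h : projDown c σ ≤ τ)
    (hρ : ρ ≤ σ ⊔ τ) : projDown c ρ ≤ τ := by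
  have hrel := c.sup (rel_projDown c σ) (c.refl τ)
  rw [sup_eq_right.2 h] at hrel
  exact (projDown_mono hρ).trans ((isLeast_projDown c _).2 hrel)

theorem mem_uncontractedArcs :
    α ∈ uncontractedArcs c ↔ projDown c (joinIrred α) = joinIrred α := by
  constructor
  · rintro ⟨σ, -, h, hα⟩
    rwa [joinIrred_eq_of_descentArcs_eq hα]
  · exact fun h => ⟨_, supIrred_joinIrred α, h, descentArcs_joinIrred α⟩

theorem joinIrred_le_projDown (hα : α ∈ uncontractedArcs c) (h : joinIrred α ≤ σ) :
    joinIrred α ≤ projDown c σ :=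
  mem_uncontractedArcs.1 hα ▸ projDown_mono h

theorem projDown_joinIrred_le (hα : α ∉ uncontractedArcs c)
    (h : inv (joinIrred α) \ {(α.right, α.left)} ⊆ inv τ) : projDown c (joinIrred α) ≤ τ := by
  have hle := projDown_le c (joinIrred α)
  refine le_iff_inv.2 ((Set.subset_sdiff_singleton (le_iff_inv.1 hle) fun hmem => ?_).trans h)
  exact hα (mem_uncontractedArcs.2 (joinIrred_eq_of_le_of_mem_inv hle hmem))

theorem descentArcs_subset_uncontractedArcs (hτ : projDown c τ = τ) :
    descentArcs τ ⊆ uncontractedArcs c := by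
  intro α hα
  by_contra hcon
  set υ := τ.trans (Equiv.swap α.left α.right)
  have hinv : inv υ = inv τ \ {(α.right, α.left)} := inv_trans_swap_of_mem_descentArcs hα
  have hbox := (mem_descentArcs.1 hα).1
  have hle : τ ≤ joinIrred α ⊔ υ := by
    refine le_iff_inv.2 fun p hp => ?_
    by_cases h : p = (α.right, α.left)
    · exact h ▸ le_iff_inv.1 le_sup_left (right_left_mem_inv_joinIrred α)
    · exact le_iff_inv.1 le_sup_right (hinv ▸ ⟨hp, h⟩)
  have hproj : projDown c (joinIrred α) ≤ υ := by
    refine projDown_joinIrred_le hcon ?_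
    rw [hinv]
    exact Set.sdiff_subset_sdiff_left (le_iff_inv.1 hbox.joinIrred_le)
  have hτυ : τ ≤ υ := hτ ▸ projDown_le_of_le_sup hproj hle
  have hmem : (α.right, α.left) ∈ inv υ :=
    le_iff_inv.1 hτυ (mem_inv.2 ⟨α.left_lt_right, hbox.right_lt_left⟩)
  exact (hinv ▸ hmem).2 rfl

theorem isArcIdeal_uncontractedArcs (c : LatticeCon (Equiv.Perm (Fin n))) :
    IsArcIdeal (uncontractedArcs c) := by
  rintro α hα ⟨a, b, S, hab, _⟩ (hleft : α.left ≤ a) (hright : b ≤ α.right)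
    (rfl : S = α.above ∩ Set.Ioo a b)
  change α.restrict hab ∈ uncontractedArcs c
  by_contra hβ
  have hβ' : projDown c (joinIrred (α.restrict hab)) ≤ pivot α a b :=
    projDown_joinIrred_le hβ (inv_joinIrred_restrict_subset_inv_pivot hleft hab hright)
  have hα' : projDown c (joinIrred α) ≤ pivot α a b :=
    projDown_le_of_le_sup hβ' (joinIrred_le_joinIrred_restrict_sup_pivot hleft hab hright)
  rw [mem_uncontractedArcs.1 hα] at hα'
  exact right_left_notMem_inv_pivot α a b (le_iff_inv.1 hα' (right_left_mem_inv_joinIrred α))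

protected theorem IsBoxArc.projDown (hα : α ∈ uncontractedArcs c) (h : IsBoxArc σ α) :
    IsBoxArc (projDown c σ) α := by
  have hle := projDown_le c σ
  have hlt := joinIrred_le_iff.1 (joinIrred_le_projDown hα h.joinIrred_le)
  refine ⟨hlt _ α.right_mem_upper _ α.left_mem_lower α.left_lt_right, ?_, ?_⟩
  · rintro y (rfl | hy)
    · exact le_rfl
    have hy' := α.above_subset hy
    refine (symm_lt_symm_of_le hle hy'.2 ((h.le_right y (Or.inr hy)).lt_of_ne ?_)).le
    exact σ.symm.injective.ne hy'.2.ne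
  · rintro x (rfl | hx)
    · exact le_rfl
    refine (symm_lt_symm_of_le hle hx.1.1 ((h.left_le x (Or.inr hx)).lt_of_ne ?_)).le
    exact σ.symm.injective.ne hx.1.1.ne

theorem IsBoxArc.of_projDown (hα : α ∈ uncontractedArcs c) (h : IsBoxArc (projDown c σ) α) :
    IsBoxArc σ α := by
  have hle : joinIrred α ≤ σ := h.joinIrred_le.trans (projDown_le c σ)
  have hrestrict : ∀ a b (hab : a < b), α.left ≤ a → b ≤ α.right →
      joinIrred (α.restrict hab) ≤ σ → (projDown c σ).symm b < (projDown c σ).symm a := by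
    intro a b hab ha hb hσ
    have hI := isArcIdeal_uncontractedArcs c α hα (α.restrict hab) ha hb rfl
    exact (mem_inv.1 (joinIrred_le_projDown hI hσ (right_left_mem_inv_joinIrred _))).2
  refine ⟨(mem_inv.1 (hle (right_left_mem_inv_joinIrred α))).2, fun y hy => ?_, fun x hx => ?_⟩
  · by_contra! hlt
    obtain ⟨z, hz, hzr, hσ⟩ := exists_joinIrred_restrict_right_le hle hy hlt
    exact (h.le_right z hz).not_gt (hrestrict _ _ hzr (α.upper_subset_Ioc hz).1.le le_rfl hσ)
  · by_contra! hlt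
    obtain ⟨z, hz, hlz, hσ⟩ := exists_joinIrred_restrict_left_le hle hx hlt
    exact (h.left_le z hz).not_gt (hrestrict _ _ hlz le_rfl (α.lower_subset_Ico hz).2.le hσ)

theorem eta_eq_maxArcs (c : LatticeCon (Equiv.Perm (Fin n))) (σ : Equiv.Perm (Fin n)) :
    eta c σ = maxArcs {α ∈ uncontractedArcs c | IsBoxArc σ α} := by
  have hbox : {α ∈ uncontractedArcs c | IsBoxArc (projDown c σ) α} =
      {α ∈ uncontractedArcs c | IsBoxArc σ α} :=
    Set.sep_ext_iff.2 fun _ hα => ⟨IsBoxArc.of_projDown hα, IsBoxArc.projDown hα⟩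
  rw [eta, descentArcs_eq_maxArcs (descentArcs_subset_uncontractedArcs (projDown_projDown c σ)),
    hbox]

end ArcDiagram

theorem mainTheorem3 (n : ℕ) (c : LatticeCon (Equiv.Perm (Fin n))) :
    ArcDiagram.IsArcIdeal (ArcDiagram.uncontractedArcs c) ∧
    ∀ σ : Equiv.Perm (Fin n),
      ArcDiagram.eta c σ =
        {α | ∃ i j : Fin n, (i, j) ∈ ArcDiagram.maxBoxesIn (ArcDiagram.uncontractedArcs c) σ ∧
          ∃ h : σ j < σ i, α = ArcDiagram.arc σ i j h} ∧
      ArcDiagram.IsNoncrossingArcDiagram (ArcDiagram.eta c σ) ∧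
      ArcDiagram.eta c σ ⊆ ArcDiagram.uncontractedArcs c := by
  open ArcDiagram in
  refine ⟨isArcIdeal_uncontractedArcs c, fun σ => ⟨?_, ?_, ?_⟩⟩
  · rw [eta_eq_maxArcs, setOf_arc_maxBoxesIn]
  · exact isNoncrossingArcDiagram_descentArcs (projDown c σ)
  · exact descentArcs_subset_uncontractedArcs (projDown_projDown c σ)
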